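/- Notation. $\mathbb C^d[z]$ is the space of $d\times 1$ vector polynomials and $w^*$ denotes the complex conjugate of $w\in\mathbb C$ (conjugate transpose for matrices). A generalized Nevanlinna pair $\{M,N\}$ consists of $d\times d$ matrix functions that are meromorphic on $\mathbb C\setminus\mathbb R$, such that $D:=\mathrm{hol}(M)\cap\mathrm{hol}(N)$ (the intersection of the domains of holomorphy) is symmetric with respect to the real axis, $M(z)N(z^*)^*-N(z)M(z^*)^*=0$ for all $z\in D$, $\operatorname{rank}[M(z)\ N(z)]=d$ for at least one $z\in D$, and the kernel $$K_{M,N}(z,w)=\frac{M(z)N(w)^*-N(z)M(w)^*}{z-w^*},\qquad z,w\in D,\ z\ne w^*,$$ has a finite number $\kappa$ of negative squares; that is, the numbers of negative eigenvalues, counted with multiplicity, of the self-adjoint matrices $\bigl[x_j^*K_{M,N}(z_j,z_i)x_i\bigr]_{i,j=1}^n$ with $n\in\mathbb N$, $x_i\in\mathbb C^d$, $z_i\in D$, $z_i\neq z_j^*$ for all $i,j$, have a maximum, equal to $\kappa$. It is a Nevanlinna pair if $\kappa=0$. A matrix kernel $K(z,w)$, $z,w\in\mathbb C$, is a Nevanlinna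 kernel determined by the pair $\{M,N\}$ if $K(z,w)=K_{M,N}(z,w)$ for all $z,w\in D$ with $z\neq w^*$. For a subspace $\mathfrak B\subseteq\mathbb C^d[z]$, $S_{\mathfrak B}$ is the operator $f(z)\mapsto zf(z)$ in $\mathfrak B$ with domain $\{f\in\mathfrak B: zf(z)\in\mathfrak B\}$; it is symmetric for an inner product $[\cdot,\cdot]$ if $[S_{\mathfrak B}f,g]=[f,S_{\mathfrak B}g]$ for all $f,g$ in its domain (which need not be dense). The reproducing kernel of $(\mathfrak B,[\cdot,\cdot])$ is the $d\times d$ matrix function $K$ such that $K(\cdot,w)x\in\mathfrak B$ and $[f,K(\cdot,w)x]=x^*f(w)$ for all $w\in\mathbb C$, $x\in\mathbb C^d$, $f\in\mathfrak B$. Statement. Let $(\mathfrak B,[\cdot,\cdot]_{\mathfrak B})$ be a finite dimensional Pontryagin subspace of $\mathbb C^d[z]$ (a finite dimensional subspace with a nondegenerate Hermitian form) whose reproducing kernel is a Nevanlinna kernel determined by a generalized Nevanlinna pair. Let $J$ be a fundamental symmetry on $\mathfrak B$, that is, $J=P_+-P_-$ where $P_\pm$ are the projections of an orthogonal decomposition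 $\mathfrak B=\mathfrak B_+\oplus\mathfrak B_-$ with $[\cdot,\cdot]_{\mathfrak B}$ positive definite on $\mathfrak B_+$ and negative definite on $\mathfrak B_-$. Then the Hilbert space $(\mathfrak B,[J\,\cdot,\cdot]_{\mathfrak B})$ has a reproducing Nevanlinna kernel determined by a Nevanlinna pair if and only if $S_{\mathfrak B}$ is symmetric in this Hilbert space. The same equivalence holds if the Nevanlinna pair is required to consist of matrix polynomials. -/

import Mathlib

open scoped Matrix ComplexConjugate Polynomial

noncomputable section

namespace NevanlinnaPolynomial

/-! ### Matrix functions, Nevanlinna pairs and Nevanlinna kernels -/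

/-- The set of nonreal complex numbers. -/
def nonreal : Set ℂ := {z | z.im ≠ 0}

/-- A `d × d` matrix function on `ℂ`, all of whose entries are meromorphic on `ℂ \ ℝ`.
The normal form fixes the value at removable singularities to be the limit, so that in
`ℂ \ ℝ` an entry is analytic at every point which is not a pole.  No condition is imposed
at the real points. -/
def MeromorphicOffReal {d : ℕ} (M : ℂ → Matrix (Fin d) (Fin d) ℂ) : Prop :=
  ∀ i j, MeromorphicNFOn (fun z => M z i j) nonreal

/-- The domain of holomorphy of a matrix function (it may contain real points). -/
def hol {d : ℕ} (M : ℂ → Matrix (Fin d) (Fin d) ℂ) : Set ℂ :=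
  {z | ∀ i j, AnalyticAt ℂ (fun ζ => M ζ i j) z}

/-- `K_{M,N}(z,w) = (M(z) N(w)^* - N(z) M(w)^*) / (z - w^*)`; only used for `z ≠ w^*`. -/
def nevKernel {d : ℕ} (M N : ℂ → Matrix (Fin d) (Fin d) ℂ) (z w : ℂ) :
    Matrix (Fin d) (Fin d) ℂ :=
  (z - conj w)⁻¹ • (M z * (N w)ᴴ - N z * (M w)ᴴ)

/-- The `n × n` matrix `[x_j^* K_{M,N}(z_j,z_i) x_i]_{i,j}`. -/
def nevGram {d : ℕ} (M N : ℂ → Matrix (Fin d) (Fin d) ℂ) {n : ℕ}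
    (x : Fin n → Fin d → ℂ) (z : Fin n → ℂ) : Matrix (Fin n) (Fin n) ℂ :=
  Matrix.of fun i j => star (x j) ⬝ᵥ (nevKernel M N (z j) (z i) *ᵥ x i)

theorem nevKernel_conjTranspose {d : ℕ} (M N : ℂ → Matrix (Fin d) (Fin d) ℂ) (z w : ℂ) :
    (nevKernel M N z w)ᴴ = nevKernel M N w z := by
  have h : (star (z - conj w))⁻¹ = -(w - conj z)⁻¹ := by
    rw [← inv_neg]
    congr 1
    simp
  rw [nevKernel, nevKernel, Matrix.conjTranspose_smul, star_inv₀, h]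
  simp [Matrix.conjTranspose_sub, Matrix.conjTranspose_mul, ← smul_neg]

theorem nevGram_isHermitian {d : ℕ} (M N : ℂ → Matrix (Fin d) (Fin d) ℂ) {n : ℕ}
    (x : Fin n → Fin d → ℂ) (z : Fin n → ℂ) : (nevGram M N x z).IsHermitian := by
  ext i j
  simp only [Matrix.conjTranspose_apply, nevGram, Matrix.of_apply]
  rw [Matrix.star_dotProduct, star_star, Matrix.star_mulVec, nevKernel_conjTranspose,
    ← Matrix.dotProduct_mulVec]

/-- The number of negative eigenvalues, counted with multiplicity, of the self-adjoint
matrix `nevGram M N x z`. -/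
def negEigenvalueCount {d : ℕ} (M N : ℂ → Matrix (Fin d) (Fin d) ℂ) {n : ℕ}
    (x : Fin n → Fin d → ℂ) (z : Fin n → ℂ) : ℕ :=
  (Finset.univ.filter fun k => (nevGram_isHermitian M N x z).eigenvalues k < 0).card

/-- The kernel `K_{M,N}` has exactly `κ` negative squares: the maximum of the numbers of
negative eigenvalues of the matrices `[x_j^* K_{M,N}(z_j,z_i) x_i]`, where the `z_i` lie in
`hol M ∩ hol N` and `z_i ≠ z_j^*` for all `i, j`, exists and equals `κ`. -/
def HasNegativeSquares {d : ℕ} (M N : ℂ → Matrix (Fin d) (Fin d) ℂ) (κ : ℕ) : Prop :=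
  IsGreatest
    {m : ℕ | ∃ (n : ℕ) (x : Fin n → Fin d → ℂ) (z : Fin n → ℂ),
      (∀ i, z i ∈ hol M ∩ hol N) ∧ (∀ i j, z i ≠ conj (z j)) ∧
      m = negEigenvalueCount M N x z} κ

/-- `{M, N}` is a generalized Nevanlinna pair with `κ` negative squares. -/
structure IsNevanlinnaPairWith {d : ℕ} (M N : ℂ → Matrix (Fin d) (Fin d) ℂ) (κ : ℕ) :
    Prop where
  meromorphic_left : MeromorphicOffReal M
  meromorphic_right : MeromorphicOffReal N
  symmetric_domain : ∀ z ∈ hol M ∩ hol N, conj z ∈ hol M ∩ hol N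
  neutral : ∀ z ∈ hol M ∩ hol N, M z * (N (conj z))ᴴ - N z * (M (conj z))ᴴ = 0
  full_rank : ∃ z ∈ hol M ∩ hol N, (Matrix.fromCols (M z) (N z)).rank = d
  negative_squares : HasNegativeSquares M N κ

/-- `{M, N}` is a generalized Nevanlinna pair. -/
def IsGeneralizedNevanlinnaPair {d : ℕ} (M N : ℂ → Matrix (Fin d) (Fin d) ℂ) : Prop :=
  ∃ κ : ℕ, IsNevanlinnaPairWith M N κ

/-- `{M, N}` is a Nevanlinna pair: there are no negative squares. -/
def IsNevanlinnaPair {d : ℕ} (M N : ℂ → Matrix (Fin d) (Fin d) ℂ) : Prop :=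
  IsNevanlinnaPairWith M N 0

/-- The kernel `K` is determined by the pair `{M, N}`: `K = K_{M,N}` wherever the right hand
side is defined. -/
def IsDeterminedBy {d : ℕ} (K : ℂ → ℂ → Matrix (Fin d) (Fin d) ℂ)
    (M N : ℂ → Matrix (Fin d) (Fin d) ℂ) : Prop :=
  ∀ z ∈ hol M ∩ hol N, ∀ w ∈ hol M ∩ hol N, z ≠ conj w → K z w = nevKernel M N z w

/-- The matrix function on `ℂ` defined by a matrix polynomial. -/
def matrixPolyFun {d : ℕ} (M : Matrix (Fin d) (Fin d) ℂ[X]) (z : ℂ) :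
    Matrix (Fin d) (Fin d) ℂ :=
  M.map (Polynomial.eval z)

/-! ### Spaces of `d × 1` vector polynomials -/

/-- The vector polynomials `ℂ^d[z]`. -/
abbrev VecPoly (d : ℕ) : Type := Fin d → ℂ[X]

/-- The value of a vector polynomial at `z`. -/
def evalVec {d : ℕ} (z : ℂ) (f : VecPoly d) : Fin d → ℂ := fun i => (f i).eval z

/-- Multiplication by the independent variable on `ℂ^d[z]`. -/
def mulX (d : ℕ) : VecPoly d →ₗ[ℂ] VecPoly d where
  toFun f := fun i => Polynomial.X * f i
  map_add' f g := by ext1 i; simp [mul_add]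
  map_smul' c f := by ext1 i; simp

/-- The operator `S_𝔅` of multiplication by the independent variable in `𝔅`, with domain
`{f ∈ 𝔅 : z f(z) ∈ 𝔅}`. -/
def mulOp {d : ℕ} (B : Submodule ℂ (VecPoly d)) : B →ₗ.[ℂ] B where
  domain := B.comap ((mulX d).comp B.subtype)
  toFun := ((mulX d).comp (B.subtype.comp (Submodule.subtype _))).codRestrict B
    fun f => f.2

/-- Sesquilinear forms, linear in the first and conjugate linear in the second variable. -/
abbrev SesqForm (V : Type*) [AddCommGroup V] [Module ℂ V] : Type _ :=
  V →ₗ[ℂ] V →ₛₗ[starRingEnd ℂ] ℂ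

/-- The inner product of a Pontryagin space.  On a finite dimensional space these are exactly
the nondegenerate Hermitian forms. -/
structure IsPontryaginForm {V : Type*} [AddCommGroup V] [Module ℂ V] [FiniteDimensional ℂ V]
    (φ : SesqForm V) : Prop where
  hermitian : ∀ f g, φ g f = conj (φ f g)
  nondegenerate : ∀ f, (∀ g, φ f g = 0) → f = 0

/-- `J` is a fundamental symmetry: `J = P₊ - P₋` for a fundamental decomposition
`V = V₊ ⊕ V₋`, that is, an orthogonal direct sum with the form positive definite on `V₊` and
negative definite on `V₋`. -/
def IsFundamentalSymmetry {V : Type*} [AddCommGroup V] [Module ℂ V]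
    (φ : SesqForm V) (J : V →ₗ[ℂ] V) : Prop :=
  ∃ Vp Vm : Submodule ℂ V, IsCompl Vp Vm ∧
    (∀ f ∈ Vp, ∀ g ∈ Vm, φ f g = 0) ∧
    (∀ f ∈ Vp, f ≠ 0 → 0 < (φ f f).re) ∧
    (∀ f ∈ Vm, f ≠ 0 → (φ f f).re < 0) ∧
    (∀ f ∈ Vp, J f = f) ∧ (∀ f ∈ Vm, J f = -f)

/-- The operator `T` (not necessarily densely defined) is symmetric for the form `φ`. -/
def IsSymmetricFor {V : Type*} [AddCommGroup V] [Module ℂ V]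
    (φ : SesqForm V) (T : V →ₗ.[ℂ] V) : Prop :=
  ∀ f g : T.domain, φ (T f) g = φ f (T g)

/-- `K` is the reproducing kernel of `(𝔅, φ)`: for all `w` and `x` the function `K(·,w) x`
belongs to `𝔅` and `φ(f, K(·,w) x) = x^* f(w)` for all `f ∈ 𝔅`. -/
def IsReproducingKernel {d : ℕ} (B : Submodule ℂ (VecPoly d)) (φ : SesqForm B)
    (K : ℂ → ℂ → Matrix (Fin d) (Fin d) ℂ) : Prop :=
  ∀ (w : ℂ) (x : Fin d → ℂ), ∃ h : B,
    (∀ z, evalVec z (h : VecPoly d) = K z w *ᵥ x) ∧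
    ∀ f : B, φ f h = star x ⬝ᵥ evalVec w (f : VecPoly d)

end NevanlinnaPolynomial

end

open scoped Matrix ComplexConjugate Polynomial

noncomputable section

namespace NevanlinnaPolynomial

open Module
open scoped ComplexOrder

/-! ### Dimension counts in linear algebra -/

/-! Write `S` for multiplication by `z` in `B` and `B(α)` for the space of values at `α`. Whether a
kernel comes from a pair is governed by two conditions: symmetry of `S`, and `dim B = dim B(α) + dim
dom S` for some `α`. The second does not mention the inner product, so it passes from the Pontryagin
form to the Hilbert one, where only symmetry remains to be decided.

Necessity (`isSymmetricFor_and_finrank_eq_of_isDeterminedBy`) is a squeeze of dimensions. Let `A` be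
the span of the pairs `(K(·,w)x, w^* K(·,w)x)`. The reproducing property makes the graph `G` of `S`
the orthogonal companion of `A` in `B × B`, so `2 dim B ≤ dim A + dim G`. The map `(f, g) ↦ z f - g`
has kernel `G` and sends `A` to functions `(M(z)N(w)^* - N(z)M(w)^*)x`; `finrank_map_pairFun_le`
bounds the dimension of that image by `2 dim B(α)`. Since `dim B(α) + dim G ≤ dim B` always holds,
all inequalities are equalities. Hence `G ⊆ A`, and `G` is orthogonal to itself, which is symmetry.

Sufficiency (`exists_polynomial_pair_of_isSymmetricFor`) is explicit. In the positive definite case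
take an orthonormal basis adapted to `dom S`; symmetry turns `(z - w^*) K(z,w)` into a sum over the
basis of `(dom S)^⊥` alone. The dimension equality leaves just enough columns to reach rank `d` by
adding constants. -/

theorem finrank_le_finrank_add_of_orthogonal_le {X Y : Type*} [AddCommGroup X] [Module ℂ X]
    [AddCommGroup Y] [Module ℂ Y] [FiniteDimensional ℂ Y] (β : Y →ₗ[ℂ] X →ₛₗ[starRingEnd ℂ] ℂ)
    (A : Submodule ℂ X) [FiniteDimensional ℂ A] (R : Submodule ℂ Y)
    (hR : ∀ y, (∀ a ∈ A, β y a = 0) → y ∈ R) :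
    finrank ℂ Y ≤ finrank ℂ A + finrank ℂ R := by
  let b := finBasis ℂ A
  let T : Y →ₗ[ℂ] (Fin (finrank ℂ A) → ℂ) :=
    { toFun := fun y i => β y (b i)
      map_add' := fun y y' => by ext i; simp
      map_smul' := fun c y => by ext i; simp }
  have hker : LinearMap.ker T ≤ R := by
    intro y hy
    apply hR
    intro a ha
    have h0 : (β y).comp A.subtype = 0 := b.ext fun i => congrFun hy i
    exact LinearMap.congr_fun h0 ⟨a, ha⟩
  have h1 := T.finrank_range_add_finrank_ker
  have h2 : finrank ℂ (LinearMap.range T) ≤ finrank ℂ A := by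
    simpa using Submodule.finrank_le (LinearMap.range T)
  have h3 := Submodule.finrank_mono hker
  omega

theorem finrank_map_add_finrank_inf_ker {X Y : Type*} [AddCommGroup X] [Module ℂ X]
    [AddCommGroup Y] [Module ℂ Y] (T : X →ₗ[ℂ] Y) (A : Submodule ℂ X) [FiniteDimensional ℂ A] :
    finrank ℂ (A.map T) + finrank ℂ (A ⊓ LinearMap.ker T : Submodule ℂ X) = finrank ℂ A := by
  have h := (T.domRestrict A).finrank_range_add_finrank_ker
  rw [LinearMap.range_domRestrict, LinearMap.ker_domRestrict] at h
  rw [← h, ← Submodule.map_comap_subtype, Submodule.finrank_map_subtype_eq]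

theorem finrank_le_of_injOn {X Y : Type*} [AddCommGroup X] [Module ℂ X]
    [AddCommGroup Y] [Module ℂ Y] (T : X →ₗ[ℂ] Y) (A : Submodule ℂ X) (R : Submodule ℂ Y)
    [FiniteDimensional ℂ R] (hT : ∀ a ∈ A, T a ∈ R) (hinj : ∀ a ∈ A, T a = 0 → a = 0) :
    finrank ℂ A ≤ finrank ℂ R := by
  refine LinearMap.finrank_le_finrank_of_injective (f := T.restrict hT) ?_
  rw [← LinearMap.ker_eq_bot, LinearMap.ker_eq_bot']
  intro a ha
  exact Subtype.ext (hinj a a.2 (congrArg Subtype.val ha))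

/-! ### Evaluation and multiplication by the independent variable -/

/-- Evaluation at `z` as a linear map. -/
def evalLin {d : ℕ} (z : ℂ) : VecPoly d →ₗ[ℂ] (Fin d → ℂ) where
  toFun := evalVec z
  map_add' f g := by ext i; simp [evalVec]
  map_smul' c f := by ext i; simp [evalVec]

@[simp] theorem evalLin_apply {d : ℕ} (z : ℂ) (f : VecPoly d) : evalLin z f = evalVec z f := rfl

theorem evalVec_add {d : ℕ} (z : ℂ) (f g : VecPoly d) :
    evalVec z (f + g) = evalVec z f + evalVec z g := map_add (evalLin z) f g

theorem evalVec_neg {d : ℕ} (z : ℂ) (f : VecPoly d) : evalVec z (-f) = -evalVec z f :=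
  map_neg (evalLin z) f

theorem evalVec_smul {d : ℕ} (z c : ℂ) (f : VecPoly d) :
    evalVec z (c • f) = c • evalVec z f := map_smul (evalLin z) c f

theorem evalVec_sum {d : ℕ} {ι : Type*} (z : ℂ) (s : Finset ι) (f : ι → VecPoly d) :
    evalVec z (∑ k ∈ s, f k) = ∑ k ∈ s, evalVec z (f k) := map_sum (evalLin z) f s

theorem evalVec_mulX {d : ℕ} (z : ℂ) (f : VecPoly d) :
    evalVec z (mulX d f) = z • evalVec z f := by
  ext i; simp [evalVec, mulX]

theorem eq_of_evalVec_eq {d : ℕ} {D : Set ℂ} (hD : D.Infinite) {f g : VecPoly d}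
    (h : ∀ z ∈ D, evalVec z f = evalVec z g) : f = g := by
  ext1 i
  exact Polynomial.eq_of_infinite_eval_eq _ _
    (hD.mono fun z hz => congrFun (h z hz) i)

theorem mem_graph_mulOp {d : ℕ} (B : Submodule ℂ (VecPoly d)) (p : B × B) :
    p ∈ (mulOp B).graph ↔ mulX d p.1 = (p.2 : VecPoly d) := by
  rw [LinearPMap.mem_graph_iff]
  constructor
  · rintro ⟨y, hy, hy'⟩
    rw [← hy, ← hy']
    rfl
  · intro h
    refine ⟨⟨p.1, ?_⟩, rfl, Subtype.ext h⟩
    change mulX d p.1 ∈ B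
    rw [h]
    exact p.2.2

theorem mem_graph_mulOp_iff_evalVec {d : ℕ} (B : Submodule ℂ (VecPoly d)) {D : Set ℂ}
    (hD : D.Infinite) (p : B × B) :
    p ∈ (mulOp B).graph ↔
      ∀ z ∈ D, z • evalVec z (p.1 : VecPoly d) = evalVec z (p.2 : VecPoly d) := by
  rw [mem_graph_mulOp]
  constructor
  · intro h z _
    rw [← h, evalVec_mulX]
  · intro h
    refine eq_of_evalVec_eq hD fun z hz => ?_
    rw [evalVec_mulX, h z hz]

theorem finrank_graph_mulOp {d : ℕ} (B : Submodule ℂ (VecPoly d)) [FiniteDimensional ℂ B] :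
    finrank ℂ (mulOp B).graph = finrank ℂ (mulOp B).domain := by
  rw [← LinearPMap.graph_map_fst_eq_domain]
  have h := finrank_map_add_finrank_inf_ker (LinearMap.fst ℂ B B) (mulOp B).graph
  have h0 : (mulOp B).graph ⊓ LinearMap.ker (LinearMap.fst ℂ B B) = ⊥ := by
    rw [eq_bot_iff]
    rintro ⟨u, v⟩ ⟨h1, h2⟩
    have h2 : u = 0 := h2
    subst h2
    rw [SetLike.mem_coe, mem_graph_mulOp] at h1
    have : v = 0 := Subtype.ext (by simpa using h1.symm)
    simp [this]
  rw [h0, finrank_bot, add_zero] at h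
  exact h.symm

/-- Multiplication by `z - α` embeds `dom S` into the elements of `B` vanishing at `α`. Equality
means that every such element can be divided by `z - α` within `B`. -/
theorem finrank_map_evalLin_add_le {d : ℕ} (B : Submodule ℂ (VecPoly d))
    [FiniteDimensional ℂ B] (α : ℂ) :
    finrank ℂ (B.map (evalLin α)) + finrank ℂ (mulOp B).domain ≤ finrank ℂ B := by
  rw [← finrank_map_add_finrank_inf_ker (evalLin α) B]
  gcongr
  have hfd : FiniteDimensional ℂ (B ⊓ LinearMap.ker (evalLin α) : Submodule ℂ (VecPoly d)) :=
    Submodule.finiteDimensional_of_le inf_le_left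
  refine finrank_le_of_injOn ((mulX d - α • LinearMap.id).comp B.subtype) _ _ ?_ ?_
  · intro f hf
    refine ⟨B.sub_mem hf (B.smul_mem _ f.2), ?_⟩
    change evalLin α (mulX d f - α • (f : VecPoly d)) = 0
    rw [map_sub, map_smul, evalLin_apply, evalVec_mulX, evalLin_apply, sub_self]
  · intro f _ hf
    have hf : mulX d f - α • (f : VecPoly d) = 0 := hf
    apply Subtype.ext
    refine eq_of_evalVec_eq (D := {α}ᶜ) (Set.finite_singleton α).infinite_compl ?_
    intro z hz
    have h1 : evalLin z (mulX d f - α • (f : VecPoly d)) = 0 := by rw [hf, map_zero]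
    rw [map_sub, map_smul, evalLin_apply, evalVec_mulX, evalLin_apply, ← sub_smul] at h1
    have h2 := (smul_eq_zero.1 h1).resolve_left (sub_ne_zero.2 hz)
    rw [h2]
    exact (map_zero (evalLin z)).symm

/-! ### The boundary form of a pair -/

/-- The form `(a, b), (a', b') ↦ b'^* a - a'^* b` on `ℂ^d × ℂ^d`. -/
def boundaryForm (d : ℕ) : SesqForm ((Fin d → ℂ) × (Fin d → ℂ)) :=
  LinearMap.mk₂'ₛₗ _ _ (fun p q => p.1 ⬝ᵥ star q.2 - p.2 ⬝ᵥ star q.1)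
    (fun p p' q => by simp [add_dotProduct]; ring)
    (fun c p q => by simp [smul_dotProduct, mul_sub])
    (fun p q q' => by simp [dotProduct_add]; ring)
    (fun c p q => by simp [dotProduct_smul, mul_sub])

theorem boundaryForm_apply {d : ℕ} (p q : (Fin d → ℂ) × (Fin d → ℂ)) :
    boundaryForm d p q = p.1 ⬝ᵥ star q.2 - p.2 ⬝ᵥ star q.1 := rfl

theorem boundaryForm_nondegenerate {d : ℕ} (p : (Fin d → ℂ) × (Fin d → ℂ))
    (h : ∀ q, boundaryForm d p q = 0) : p = 0 := by
  have h1 : p.1 = 0 := by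
    have := h (0, p.1)
    rw [boundaryForm_apply] at this
    simpa [dotProduct_star_self_eq_zero] using this
  have h2 : p.2 = 0 := by
    have := h (p.2, 0)
    rw [boundaryForm_apply] at this
    simpa [dotProduct_star_self_eq_zero] using this
  exact Prod.ext h1 h2

/-- The vector `(N(w)^* x, M(w)^* x)`, as a linear function of `x`. -/
def pairAdjoint {d : ℕ} (M N : ℂ → Matrix (Fin d) (Fin d) ℂ) (w : ℂ) :
    (Fin d → ℂ) →ₗ[ℂ] (Fin d → ℂ) × (Fin d → ℂ) :=
  (N w)ᴴ.mulVecLin.prod (M w)ᴴ.mulVecLin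

/-- The map `(a, b) ↦ M(z) a - N(z) b`. -/
def pairEval {d : ℕ} (M N : ℂ → Matrix (Fin d) (Fin d) ℂ) (z : ℂ) :
    (Fin d → ℂ) × (Fin d → ℂ) →ₗ[ℂ] (Fin d → ℂ) :=
  (M z).mulVecLin.comp (LinearMap.fst _ _ _) - (N z).mulVecLin.comp (LinearMap.snd _ _ _)

theorem pairEval_apply {d : ℕ} (M N : ℂ → Matrix (Fin d) (Fin d) ℂ) (z : ℂ)
    (p : (Fin d → ℂ) × (Fin d → ℂ)) : pairEval M N z p = M z *ᵥ p.1 - N z *ᵥ p.2 := rfl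

theorem pairEval_pairAdjoint {d : ℕ} (M N : ℂ → Matrix (Fin d) (Fin d) ℂ) (z w : ℂ)
    (x : Fin d → ℂ) :
    pairEval M N z (pairAdjoint M N w x) = (M z * (N w)ᴴ - N z * (M w)ᴴ) *ᵥ x := by
  simp [pairEval_apply, pairAdjoint, Matrix.sub_mulVec]

/-- By this duality the common kernel of the maps `pairEval M N w`, `w ∈ D`, is the orthogonal
companion of `pairSpan M N D`. -/
theorem boundaryForm_pairAdjoint {d : ℕ} (M N : ℂ → Matrix (Fin d) (Fin d) ℂ) (w : ℂ)
    (p : (Fin d → ℂ) × (Fin d → ℂ)) (x : Fin d → ℂ) :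
    boundaryForm d p (pairAdjoint M N w x) = star x ⬝ᵥ pairEval M N w p := by
  change p.1 ⬝ᵥ star ((M w)ᴴ *ᵥ x) - p.2 ⬝ᵥ star ((N w)ᴴ *ᵥ x) = _
  simp only [Matrix.star_mulVec, Matrix.conjTranspose_conjTranspose, pairEval_apply,
    dotProduct_sub]
  rw [dotProduct_comm, dotProduct_comm p.2, Matrix.dotProduct_mulVec, Matrix.dotProduct_mulVec]

theorem pairAdjoint_injective {d : ℕ} (M N : ℂ → Matrix (Fin d) (Fin d) ℂ) (α : ℂ)
    (h : (Matrix.fromCols (M α) (N α)).rank = d) (y : Fin d → ℂ)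
    (hy : pairAdjoint M N α y = 0) : y = 0 := by
  rw [← Matrix.rank_conjTranspose, Matrix.rank] at h
  have h1 := (Matrix.fromCols (M α) (N α))ᴴ.mulVecLin.finrank_range_add_finrank_ker
  rw [h, finrank_fin_fun] at h1
  have h2 : LinearMap.ker (Matrix.fromCols (M α) (N α))ᴴ.mulVecLin = ⊥ :=
    Submodule.finrank_eq_zero.1 (by omega)
  rw [← Submodule.mem_bot ℂ, ← h2, LinearMap.mem_ker, Matrix.mulVecLin_apply,
    Matrix.conjTranspose_fromCols_eq_fromRows_conjTranspose, Matrix.fromRows_mulVec]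
  have hN : (N α)ᴴ *ᵥ y = 0 := congrArg Prod.fst hy
  have hM : (M α)ᴴ *ᵥ y = 0 := congrArg Prod.snd hy
  rw [hN, hM]
  ext i
  cases i <;> rfl

/-- The span of the vectors `(N(w)^* x, M(w)^* x)` with `w ∈ D`. -/
def pairSpan {d : ℕ} (M N : ℂ → Matrix (Fin d) (Fin d) ℂ) (D : Set ℂ) :
    Submodule ℂ ((Fin d → ℂ) × (Fin d → ℂ)) :=
  Submodule.span ℂ (Set.range fun p : D × (Fin d → ℂ) => pairAdjoint M N p.1 p.2)

/-- The map `(a, b) ↦ (z ↦ M(z) a - N(z) b)` into the functions on `D`. -/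
def pairFun {d : ℕ} (M N : ℂ → Matrix (Fin d) (Fin d) ℂ) (D : Set ℂ) :
    (Fin d → ℂ) × (Fin d → ℂ) →ₗ[ℂ] (D → Fin d → ℂ) :=
  LinearMap.pi fun z => pairEval M N z

/-- With `E` the span and `R` its isotropic part for the boundary form, the left side is `dim E -
dim R`. Nondegeneracy gives `dim E + dim R ≤ 2d`, and the rank condition at `α` gives `d - dim R` as
a lower bound for the dimension of the values at `α`. -/
theorem finrank_map_pairFun_le {d : ℕ} (M N : ℂ → Matrix (Fin d) (Fin d) ℂ) (D : Set ℂ)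
    {α : ℂ} (hα : α ∈ D) (h : (Matrix.fromCols (M α) (N α)).rank = d) :
    finrank ℂ ((pairSpan M N D).map (pairFun M N D)) ≤
      2 * finrank ℂ ((pairSpan M N D).map (pairEval M N α)) := by
  set E := pairSpan M N D with hE
  set R := E ⊓ LinearMap.ker (pairFun M N D) with hR
  have h1 : finrank ℂ (E.map (pairFun M N D)) + finrank ℂ R = finrank ℂ E :=
    finrank_map_add_finrank_inf_ker (pairFun M N D) E
  have h2 : finrank ℂ E + finrank ℂ R ≤ d + d := by
    obtain ⟨C, hC⟩ := E.exists_isCompl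
    have h3 := Submodule.finrank_add_eq_of_isCompl hC
    -- `R` is orthogonal to `E`, so by nondegeneracy it pairs faithfully with the complement `C`,
    -- whence `dim R ≤ dim C`.
    have h4 := finrank_le_finrank_add_of_orthogonal_le ((boundaryForm d).comp R.subtype) C ⊥ (by
      intro y hy
      rw [Submodule.mem_bot]
      apply Subtype.ext
      apply boundaryForm_nondegenerate
      intro q
      have hEq : ∀ e ∈ E, boundaryForm d y e = 0 := by
        intro e he
        have : E ≤ LinearMap.ker (boundaryForm d y) := by
          rw [hE, pairSpan, Submodule.span_le]
          rintro _ ⟨⟨w, x⟩, rfl⟩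
          have hw : pairEval M N w y = 0 := congrFun (show pairFun M N D y = 0 from y.2.2) w
          rw [SetLike.mem_coe, LinearMap.mem_ker, boundaryForm_pairAdjoint, hw, dotProduct_zero]
        exact this he
      have hq : q ∈ E ⊔ C := by rw [hC.sup_eq_top]; trivial
      obtain ⟨e, he, c, hc, rfl⟩ := Submodule.mem_sup.1 hq
      rw [map_add, hEq e he, zero_add]
      exact hy c hc)
    rw [finrank_prod, finrank_fin_fun] at h3
    rw [finrank_bot] at h4
    omega
  have h5 : d ≤ finrank ℂ (E.map (pairEval M N α)) + finrank ℂ R := by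
    let β : (Fin d → ℂ) →ₗ[ℂ] (Fin d → ℂ) →ₛₗ[starRingEnd ℂ] ℂ :=
      LinearMap.mk₂'ₛₗ _ _ (fun p q => p ⬝ᵥ star q)
        (fun p p' q => by simp [add_dotProduct])
        (fun c p q => by simp [smul_dotProduct])
        (fun p q q' => by simp [dotProduct_add])
        (fun c p q => by simp [dotProduct_smul])
    -- If `y` is orthogonal to the values at `α`, then `pairAdjoint M N α y` lies in `R`: the
    -- numerator is skew under adjoint and exchange of `z, w`, so testing against `u` itself gives
    -- `u^* u = 0`.
    have h6 := finrank_le_finrank_add_of_orthogonal_le β (E.map (pairEval M N α))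
      (R.comap (pairAdjoint M N α)) (by
        intro y hy
        refine ⟨Submodule.subset_span ⟨(⟨α, hα⟩, y), rfl⟩, ?_⟩
        ext1 w
        change pairEval M N w (pairAdjoint M N α y) = 0
        rw [pairEval_pairAdjoint, ← dotProduct_star_self_eq_zero]
        set u := (M w * (N α)ᴴ - N w * (M α)ᴴ) *ᵥ y
        have h7 : y ⬝ᵥ star (pairEval M N α (pairAdjoint M N w u)) = 0 :=
          hy _ (Submodule.mem_map_of_mem (Submodule.subset_span ⟨(w, u), rfl⟩))
        rw [pairEval_pairAdjoint, Matrix.star_mulVec, dotProduct_comm,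
          ← Matrix.dotProduct_mulVec] at h7
        rw [← neg_eq_zero, ← h7, ← dotProduct_neg, ← Matrix.neg_mulVec]
        simp)
    have h8 : finrank ℂ (R.comap (pairAdjoint M N α)) ≤ finrank ℂ R :=
      finrank_le_of_injOn (pairAdjoint M N α) _ _ (fun a ha => ha)
        fun a _ => pairAdjoint_injective M N α h a
    rw [finrank_fin_fun] at h6
    omega
  omega

/-! ### Spaces with a Nevanlinna kernel -/

theorem infinite_hol_inter {d : ℕ} {M N : ℂ → Matrix (Fin d) (Fin d) ℂ} {α : ℂ}
    (hα : α ∈ hol M ∩ hol N) : (hol M ∩ hol N).Infinite := by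
  have hopen : ∀ L : ℂ → Matrix (Fin d) (Fin d) ℂ, IsOpen (hol L) := by
    intro L
    have : hol L = ⋂ i, ⋂ j, {z | AnalyticAt ℂ (fun ζ => L ζ i j) z} := by
      ext z; simp [hol]
    rw [this]
    exact isOpen_iInter_of_finite fun i => isOpen_iInter_of_finite fun j =>
      isOpen_analyticAt ℂ _
  exact infinite_of_mem_nhds α (((hopen M).inter (hopen N)).mem_nhds hα)

theorem isSymmetricFor_and_finrank_eq_of_isDeterminedBy {d : ℕ} (B : Submodule ℂ (VecPoly d))
    [FiniteDimensional ℂ B] (ψ : SesqForm B) {K : ℂ → ℂ → Matrix (Fin d) (Fin d) ℂ}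
    (hK : IsReproducingKernel B ψ K) {M N : ℂ → Matrix (Fin d) (Fin d) ℂ}
    (hMN : IsGeneralizedNevanlinnaPair M N) (hdet : IsDeterminedBy K M N) :
    IsSymmetricFor ψ (mulOp B) ∧
      ∃ α, finrank ℂ B = finrank ℂ (B.map (evalLin α)) + finrank ℂ (mulOp B).domain := by
  obtain ⟨κ, hMN⟩ := hMN
  obtain ⟨α, hα, hrank⟩ := hMN.full_rank
  set D := hol M ∩ hol N with hDdef
  have hD : D.Infinite := infinite_hol_inter hα
  have hP : ∀ z ∈ D, ∀ w ∈ D,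
      M z * (N w)ᴴ - N z * (M w)ᴴ = (z - conj w) • K z w := by
    intro z hz w hw
    -- Where the kernel quotient is undefined, neutrality of the pair gives the identity.
    by_cases hzw : z = conj w
    · have hw' : w = conj z := by rw [hzw, Complex.conj_conj]
      subst hw'
      rw [hMN.neutral z hz]
      simp
    · rw [hdet z hz w hw hzw, nevKernel, smul_smul, mul_inv_cancel₀ (sub_ne_zero.2 hzw), one_smul]
  choose k hk hrep using hK
  let a : D × (Fin d → ℂ) → B × B := fun p => (k p.1 p.2, conj (p.1 : ℂ) • k p.1 p.2)
  let A : Submodule ℂ (B × B) := Submodule.span ℂ (Set.range a)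
  set G := (mulOp B).graph with hG
  have hrepA : ∀ p : B × B, (∀ q ∈ A, ψ p.1 q.2 - ψ p.2 q.1 = 0) → p ∈ G := by
    intro p hp
    rw [hG, mem_graph_mulOp_iff_evalVec B hD]
    intro w hw
    rw [← sub_eq_zero, ← dotProduct_star_self_eq_zero, dotProduct_sub,
      dotProduct_smul]
    set x := w • evalVec w (p.1 : VecPoly d) - evalVec w (p.2 : VecPoly d)
    have h : ψ p.1 (conj w • k w x) - ψ p.2 (k w x) = 0 :=
      hp _ (Submodule.subset_span ⟨(⟨w, hw⟩, x), rfl⟩)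
    rw [map_smulₛₗ, Complex.conj_conj, hrep, hrep] at h
    exact h
  have hAsymm : ∀ p ∈ G, ∀ q ∈ A, ψ p.1 q.2 - ψ p.2 q.1 = 0 := by
    intro p hp q hq
    induction hq using Submodule.span_induction with
    | mem q hq =>
      obtain ⟨⟨w, x⟩, rfl⟩ := hq
      have h := (mem_graph_mulOp_iff_evalVec B hD p).1 hp w w.2
      change ψ p.1 (conj (w : ℂ) • k w x) - ψ p.2 (k w x) = 0
      rw [map_smulₛₗ, Complex.conj_conj, hrep, hrep, ← h, dotProduct_smul, sub_self]
    | zero => simp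
    | add q q' _ _ h h' =>
      rw [Prod.snd_add, Prod.fst_add, map_add, map_add, add_sub_add_comm, h, h', add_zero]
    | smul c q _ h =>
      rw [Prod.smul_snd, Prod.smul_fst, map_smulₛₗ, map_smulₛₗ, ← smul_sub, h, smul_zero]
  let β : B × B →ₗ[ℂ] B × B →ₛₗ[starRingEnd ℂ] ℂ :=
    LinearMap.mk₂'ₛₗ _ _ (fun p q => ψ p.1 q.2 - ψ p.2 q.1)
      (fun p p' q => by simp; ring) (fun c p q => by simp [mul_sub])
      (fun p q q' => by simp; ring) (fun c p q => by simp [mul_sub])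
  have h1 : finrank ℂ B + finrank ℂ B ≤ finrank ℂ A + finrank ℂ G := by
    rw [← finrank_prod]
    exact finrank_le_finrank_add_of_orthogonal_le β A G hrepA
  let Γ : B × B →ₗ[ℂ] (D → Fin d → ℂ) := LinearMap.pi fun z =>
    (z : ℂ) • (evalLin (z : ℂ)).comp (B.subtype.comp (LinearMap.fst ℂ B B)) -
      (evalLin (z : ℂ)).comp (B.subtype.comp (LinearMap.snd ℂ B B))
  have hΓker : LinearMap.ker Γ ≤ G := by
    intro p hp
    rw [hG, mem_graph_mulOp_iff_evalVec B hD]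
    intro z hz
    exact sub_eq_zero.1 (congrFun (show Γ p = 0 from hp) ⟨z, hz⟩)
  have hΓmap : A.map Γ = (pairSpan M N D).map (pairFun M N D) := by
    rw [pairSpan, Submodule.map_span, Submodule.map_span, ← Set.range_comp, ← Set.range_comp]
    congr 2
    ext1 ⟨w, x⟩
    ext1 z
    change (z : ℂ) • evalVec z (k w x : VecPoly d) -
      evalLin z (conj (w : ℂ) • (k w x : VecPoly d)) = pairEval M N z (pairAdjoint M N w x)
    rw [pairEval_pairAdjoint, hP z z.2 w w.2, map_smul, evalLin_apply, ← sub_smul, hk,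
      Matrix.smul_mulVec]
  have h2 := finrank_map_add_finrank_inf_ker Γ A
  have h3 := finrank_map_pairFun_le M N D hα hrank
  have h4 : finrank ℂ ((pairSpan M N D).map (pairEval M N α)) ≤
      finrank ℂ (B.map (evalLin α)) := by
    apply Submodule.finrank_mono
    rw [pairSpan, Submodule.map_span, ← Set.range_comp, Submodule.span_le]
    rintro _ ⟨⟨w, x⟩, rfl⟩
    refine ⟨(α - conj (w : ℂ)) • (k w x : VecPoly d), B.smul_mem _ (k w x).2, ?_⟩
    change _ = pairEval M N α (pairAdjoint M N w x)
    rw [pairEval_pairAdjoint, hP α hα w w.2, map_smul, evalLin_apply, hk, Matrix.smul_mulVec]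
  have h5 := finrank_map_evalLin_add_le B α
  have h6 : finrank ℂ G = finrank ℂ (mulOp B).domain := finrank_graph_mulOp B
  have h7 : finrank ℂ (A ⊓ LinearMap.ker Γ : Submodule ℂ (B × B)) ≤ finrank ℂ (A ⊓ G :) :=
    Submodule.finrank_mono (inf_le_inf_left A hΓker)
  have h8 : finrank ℂ (A ⊓ G : Submodule ℂ (B × B)) ≤ finrank ℂ G :=
    Submodule.finrank_mono inf_le_right
  rw [hΓmap] at h2
  -- The chain `2 dim B ≤ dim Γ(A) + dim (A ⊓ G) + dim G ≤ 2 dim B(α) + 2 dim G ≤ 2 dim B`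
  -- collapses.
  have h9 : A ⊓ G = G := Submodule.eq_of_le_of_finrank_le inf_le_right (by omega)
  refine ⟨?_, α, by omega⟩
  intro f g
  have hg : ((g : B), mulOp B g) ∈ A := (inf_eq_right.1 h9) ((mulOp B).mem_graph g)
  exact (sub_eq_zero.1 (hAsymm _ ((mulOp B).mem_graph f) _ hg)).symm

/-! ### Positive definite forms -/

/-- The vectors are orthonormal bases of `Uᗮ` and `U`; only the resulting expansion and the number
`s = dim Uᗮ` are needed later. -/
theorem exists_expansion_of_posDef {V : Type*} [AddCommGroup V] [Module ℂ V]
    [FiniteDimensional ℂ V] (ψ : SesqForm V) (herm : ∀ f g, ψ g f = conj (ψ f g))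
    (pos : ∀ f, f ≠ 0 → 0 < (ψ f f).re) (U : Submodule ℂ V) :
    ∃ s r : ℕ, finrank ℂ V = s + finrank ℂ U ∧ ∃ (e : Fin s → V) (u : Fin r → U),
      ∀ f, f = ∑ k, ψ f (e k) • e k + ∑ l, ψ f (u l) • (u l : V) := by
  let core : InnerProductSpace.Core ℂ V :=
    -- The arguments are swapped because `inner` is conjugate linear in its first variable.
    { inner := fun f g => ψ g f
      conj_inner_symm := fun f g => (herm f g).symm
      re_inner_nonneg := fun f => by
        by_cases hf : f = 0
        · simp [hf]
        · exact (pos f hf).le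
      add_left := fun f g h => map_add (ψ h) f g
      smul_left := fun f g c => by simp
      definite := fun f hf => by
        by_contra hne
        have h := pos f hne
        rw [show ψ f f = 0 from hf] at h
        simp at h }
  let : NormedAddCommGroup V := core.toNormedAddCommGroup
  let : InnerProductSpace ℂ V := InnerProductSpace.ofCore core.toCore
  let b := stdOrthonormalBasis ℂ U
  let c := stdOrthonormalBasis ℂ Uᗮ
  refine ⟨finrank ℂ Uᗮ, finrank ℂ U, by rw [add_comm, Submodule.finrank_add_finrank_orthogonal],
    fun k => c k, fun l => b l, fun f => ?_⟩
  have hb := congrArg Subtype.val (b.sum_repr' (U.orthogonalProjectionOnto f))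
  have hc := congrArg Subtype.val (c.sum_repr' (Uᗮ.orthogonalProjectionOnto f))
  simp only [Submodule.inner_orthogonalProjectionOnto_eq_of_mem_left, Submodule.coe_sum,
    Submodule.coe_smul] at hb hc
  have h := U.starProjection_add_starProjection_orthogonal f
  change (U.orthogonalProjectionOnto f : V) + (Uᗮ.orthogonalProjectionOnto f : V) = f at h
  rw [← hb, ← hc, add_comm] at h
  exact h.symm

/-- The form of a Pontryagin space becomes positive definite after composition with a
fundamental symmetry. -/
theorem IsFundamentalSymmetry.comp_hermitian_and_posDef {V : Type*} [AddCommGroup V] [Module ℂ V]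
    {φ : SesqForm V} (herm : ∀ f g, φ g f = conj (φ f g)) {J : V →ₗ[ℂ] V}
    (hJ : IsFundamentalSymmetry φ J) :
    (∀ f g, (φ.comp J) g f = conj ((φ.comp J) f g)) ∧
      ∀ f, f ≠ 0 → 0 < ((φ.comp J) f f).re := by
  obtain ⟨Vp, Vm, hc, horth, hp, hm, hJp, hJm⟩ := hJ
  have hsplit : ∀ f : V, ∃ p ∈ Vp, ∃ m ∈ Vm, p + m = f := fun f =>
    Submodule.mem_sup.1 (by rw [hc.sup_eq_top]; trivial)
  have horth' : ∀ f ∈ Vm, ∀ g ∈ Vp, φ f g = 0 := fun f hf g hg => by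
    rw [herm g f, horth g hg f hf, map_zero]
  have hval : ∀ p ∈ Vp, ∀ m ∈ Vm, ∀ p' ∈ Vp, ∀ m' ∈ Vm,
      (φ.comp J) (p + m) (p' + m') = φ p p' - φ m m' := by
    intro p hp m hm p' hp' m' hm'
    simp [hJp p hp, hJm m hm, horth p hp m' hm', horth' m hm p' hp', sub_eq_add_neg]
  constructor
  · intro f g
    obtain ⟨p, hp, m, hm, rfl⟩ := hsplit f
    obtain ⟨p', hp', m', hm', rfl⟩ := hsplit g
    rw [hval p hp m hm p' hp' m' hm', hval p' hp' m' hm' p hp m hm, herm p p', herm m m', map_sub]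
  · intro f hf
    obtain ⟨p, hpp, m, hmm, rfl⟩ := hsplit f
    rw [hval p hpp m hmm p hpp m hmm, Complex.sub_re]
    by_cases hp0 : p = 0
    · have hm0 : m ≠ 0 := by
        rintro rfl
        exact hf (by simp [hp0])
      have := hm m hmm hm0
      simp [hp0]
      exact this
    · have h1 := hp p hpp hp0
      by_cases hm0 : m = 0
      · simpa [hm0] using h1
      · linarith [hm m hmm hm0]

/-! ### Nevanlinna pairs of matrix polynomials -/

theorem hol_matrixPolyFun {d : ℕ} (M : Matrix (Fin d) (Fin d) ℂ[X]) :
    hol (matrixPolyFun M) = Set.univ :=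
  Set.eq_univ_of_forall fun _ i j => (M i j).differentiable.analyticAt _

theorem meromorphicOffReal_matrixPolyFun {d : ℕ} (M : Matrix (Fin d) (Fin d) ℂ[X]) :
    MeromorphicOffReal (matrixPolyFun M) :=
  fun i j _ _ => ((M i j).differentiable.analyticAt _).meromorphicNFAt

theorem posSemidef_nevGram {d : ℕ} {ι : Type*} [Fintype ι]
    {M N : ℂ → Matrix (Fin d) (Fin d) ℂ} (Ev : ℂ → Matrix (Fin d) ι ℂ) {n : ℕ}
    (x : Fin n → Fin d → ℂ) (z : Fin n → ℂ)
    (h : ∀ i j, nevKernel M N (z j) (z i) = Ev (z j) * (Ev (z i))ᴴ) :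
    (nevGram M N x z).PosSemidef := by
  have hG : nevGram M N x z = (Matrix.of fun k i => (star (x i) ᵥ* Ev (z i)) k)ᴴ *
      Matrix.of fun k i => (star (x i) ᵥ* Ev (z i)) k := by
    ext i j
    rw [nevGram, Matrix.of_apply, h, ← Matrix.mulVec_mulVec, Matrix.dotProduct_mulVec,
      dotProduct_comm, Matrix.mul_apply]
    refine Finset.sum_congr rfl fun k _ => ?_
    congr 1
    rw [Matrix.conjTranspose_apply, Matrix.of_apply, ← Pi.star_apply, Matrix.star_vecMul, star_star]
  rw [hG]
  exact Matrix.posSemidef_conjTranspose_mul_self _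

theorem isNevanlinnaPair_matrixPolyFun {d : ℕ} {ι : Type*} [Fintype ι]
    {M N : Matrix (Fin d) (Fin d) ℂ[X]} (Ev : ℂ → Matrix (Fin d) ι ℂ)
    (hP : ∀ z w, matrixPolyFun M z * (matrixPolyFun N w)ᴴ -
      matrixPolyFun N z * (matrixPolyFun M w)ᴴ = (z - conj w) • (Ev z * (Ev w)ᴴ))
    {α : ℂ} (hα : (Matrix.fromCols (matrixPolyFun M α) (matrixPolyFun N α)).rank = d) :
    IsNevanlinnaPair (matrixPolyFun M) (matrixPolyFun N) ∧
      IsDeterminedBy (fun z w => Ev z * (Ev w)ᴴ) (matrixPolyFun M) (matrixPolyFun N) := by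
  have hker : ∀ z w, z ≠ conj w →
      nevKernel (matrixPolyFun M) (matrixPolyFun N) z w = Ev z * (Ev w)ᴴ := by
    intro z w hzw
    rw [nevKernel, hP, smul_smul, inv_mul_cancel₀ (sub_ne_zero.2 hzw), one_smul]
  refine ⟨⟨meromorphicOffReal_matrixPolyFun M, meromorphicOffReal_matrixPolyFun N, ?_, ?_,
    ⟨α, ?_, hα⟩, ?_, ?_⟩, fun z _ w _ hzw => (hker z w hzw).symm⟩
  · simp [hol_matrixPolyFun]
  · intro z _
    rw [hP, Complex.conj_conj, sub_self, zero_smul]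
  · simp [hol_matrixPolyFun]
  -- The empty Gram matrix attains the count `0`.
  · exact ⟨0, fun _ => 0, fun _ => 0, fun i => i.elim0, fun i => i.elim0, by
      simp [negEigenvalueCount]⟩
  · rintro m ⟨n, x, z, -, hz, rfl⟩
    have hpos := posSemidef_nevGram (M := matrixPolyFun M) (N := matrixPolyFun N) Ev x z
      fun i j => hker _ _ (hz j i)
    rw [negEigenvalueCount, Finset.card_eq_zero.2]
    exact Finset.filter_eq_empty_iff.2 fun k _ => not_lt.2 (hpos.eigenvalues_nonneg k)

/-- A Green identity with conjugates as free variables: primed letters and `w` stand for conjugated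
values. Expanding `z b` and `w b'`, the `τ` terms agree and cancel, since `τ` enters the second
hypothesis transposed; the `σ` terms are absorbed by the corrections. -/
theorem sum_boundary_eq {s r : ℕ} (z w : ℂ) (a a' : Fin s → ℂ) (b b' : Fin r → ℂ)
    (σ σ' : Fin r → Fin s → ℂ) (τ : Fin r → Fin r → ℂ)
    (hb : ∀ l, z * b l = ∑ k, σ l k * a k + ∑ m, τ l m * b m)
    (hb' : ∀ l, w * b' l = ∑ k, σ' l k * a' k + ∑ m, τ m l * b' m) :
    ∑ k, ((z * a k - ∑ l, σ' l k * b l) * a' k) - ∑ k, (a k * (w * a' k - ∑ l, σ l k * b' l)) =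
      (z - w) * (∑ k, a k * a' k + ∑ l, b l * b' l) := by
  have h1 : z * ∑ l, b l * b' l =
      ∑ k, (∑ l, σ l k * b' l) * a k + ∑ m, ∑ l, τ l m * b m * b' l := by
    rw [Finset.mul_sum]
    simp_rw [← mul_assoc, hb, add_mul, Finset.sum_add_distrib, Finset.sum_mul]
    rw [Finset.sum_comm, Finset.sum_comm (f := fun l m => τ l m * b m * b' l)]
    congr 1
    exact Finset.sum_congr rfl fun k _ => Finset.sum_congr rfl fun l _ => by ring
  have h2 : w * ∑ l, b l * b' l =
      ∑ k, (∑ l, σ' l k * b l) * a' k + ∑ m, ∑ l, τ l m * b m * b' l := by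
    rw [Finset.mul_sum]
    simp_rw [mul_left_comm w, hb', mul_add, Finset.sum_add_distrib, Finset.sum_mul, Finset.mul_sum]
    rw [Finset.sum_comm]
    congr 1
    · exact Finset.sum_congr rfl fun k _ => Finset.sum_congr rfl fun l _ => by ring
    · exact Finset.sum_congr rfl fun k _ => Finset.sum_congr rfl fun l _ => by ring
  have h3 : ∑ k, ((z * a k - ∑ l, σ' l k * b l) * a' k) =
      z * ∑ k, a k * a' k - ∑ k, (∑ l, σ' l k * b l) * a' k := by
    rw [Finset.mul_sum, ← Finset.sum_sub_distrib]
    exact Finset.sum_congr rfl fun k _ => by ring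
  have h4 : ∑ k, (a k * (w * a' k - ∑ l, σ l k * b' l)) =
      w * ∑ k, a k * a' k - ∑ k, (∑ l, σ l k * b' l) * a k := by
    rw [Finset.mul_sum, ← Finset.sum_sub_distrib]
    exact Finset.sum_congr rfl fun k _ => by ring
  rw [h3, h4, mul_add, sub_mul, sub_mul, h1, h2]
  ring

theorem exists_polynomial_pair_of_isSymmetricFor {d : ℕ} (B : Submodule ℂ (VecPoly d))
    [FiniteDimensional ℂ B] (ψ : SesqForm B) (herm : ∀ f g, ψ g f = conj (ψ f g))
    (pos : ∀ f, f ≠ 0 → 0 < (ψ f f).re) (hS : IsSymmetricFor ψ (mulOp B)) {α : ℂ}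
    (hα : finrank ℂ B = finrank ℂ (B.map (evalLin α)) + finrank ℂ (mulOp B).domain) :
    ∃ K : ℂ → ℂ → Matrix (Fin d) (Fin d) ℂ, IsReproducingKernel B ψ K ∧
      ∃ M N : Matrix (Fin d) (Fin d) ℂ[X],
        IsNevanlinnaPair (matrixPolyFun M) (matrixPolyFun N) ∧
          IsDeterminedBy K (matrixPolyFun M) (matrixPolyFun N) := by
  obtain ⟨s, r, hs, e, u, hexp⟩ := exists_expansion_of_posDef ψ herm pos (mulOp B).domain
  obtain ⟨C, hC⟩ := (B.map (evalLin α)).exists_isCompl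
  have hCd := Submodule.finrank_add_eq_of_isCompl hC
  rw [finrank_fin_fun] at hCd
  let c := finBasis ℂ C
  -- The dimension equality gives `s = dim B(α)`, so `s + dim C = d`.
  let eq : Fin d ≃ Fin s ⊕ Fin (finrank ℂ C) :=
    (finCongr (by omega)).trans finSumFinEquiv.symm
  let b : Fin s ⊕ Fin r → B := Sum.elim e fun l => u l
  let Ev : ℂ → Matrix (Fin d) (Fin s ⊕ Fin r) ℂ := fun z =>
    Matrix.of fun i k => evalVec z (b k : VecPoly d) i
  let σ : Fin r → Fin s → ℂ := fun l k => ψ (mulOp B (u l)) (e k)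
  let τ : Fin r → Fin r → ℂ := fun l m => ψ (mulOp B (u l)) (u m)
  -- This is where the symmetry of `S` enters the construction.
  have hτ : ∀ l m, conj (τ l m) = τ m l := fun l m => by
    change conj (ψ (mulOp B (u l)) (u m)) = ψ (mulOp B (u m)) (u l)
    rw [← herm, hS]
  -- `X e_k` need not lie in `B`; the subtracted part of `dom S` cancels the cross terms coming from
  -- `S u_l`.
  let g : Fin s → VecPoly d := fun k =>
    mulX d (e k) - ∑ l, conj (σ l k) • ((u l : B) : VecPoly d)
  let M : Matrix (Fin d) (Fin d) ℂ[X] := Matrix.of fun i j =>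
    Sum.elim (fun k => g k i) (fun m => Polynomial.C ((c m : Fin d → ℂ) i)) (eq j)
  let N : Matrix (Fin d) (Fin d) ℂ[X] := Matrix.of fun i j =>
    Sum.elim (fun k => (e k : VecPoly d) i) (fun _ => 0) (eq j)
  have hexpS : ∀ z l i, z * evalVec z ((u l : B) : VecPoly d) i =
      ∑ k, σ l k * evalVec z (e k : VecPoly d) i +
        ∑ m, τ l m * evalVec z ((u m : B) : VecPoly d) i := by
    intro z l i
    have h1 : ((mulOp B (u l) : B) : VecPoly d) = mulX d (u l : B) := rfl
    have h2 := congrArg (fun f : B => evalLin z (f : VecPoly d) i) (hexp (mulOp B (u l)))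
    simpa [h1, evalVec_mulX, evalVec_add, evalVec_sum, evalVec_smul] using h2
  have hg : ∀ z k i, evalVec z (g k) i = z * evalVec z (e k : VecPoly d) i -
      ∑ l, conj (σ l k) * evalVec z ((u l : B) : VecPoly d) i := by
    intro z k i
    simp [g, sub_eq_add_neg, evalVec_add, evalVec_neg, evalVec_sum, evalVec_smul, evalVec_mulX]
  have hP : ∀ z w, matrixPolyFun M z * (matrixPolyFun N w)ᴴ -
      matrixPolyFun N z * (matrixPolyFun M w)ᴴ = (z - conj w) • (Ev z * (Ev w)ᴴ) := by
    intro z w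
    ext i j
    have key := sum_boundary_eq z (conj w) (fun k => evalVec z (e k : VecPoly d) i)
      (fun k => conj (evalVec w (e k : VecPoly d) j))
      (fun l => evalVec z ((u l : B) : VecPoly d) i)
      (fun l => conj (evalVec w ((u l : B) : VecPoly d) j)) σ (fun l k => conj (σ l k)) τ
      (fun l => hexpS z l i) (fun l => by
        rw [← map_mul, hexpS w l j]
        simp [hτ])
    simp only [← hg] at key
    have hgc : ∀ k, conj w * conj (evalVec w (e k : VecPoly d) j) -
        ∑ l, σ l k * conj (evalVec w ((u l : B) : VecPoly d) j) = conj (evalVec w (g k) j) := by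
      intro k
      simp [hg]
    simp only [hgc] at key
    rw [Matrix.sub_apply, Matrix.mul_apply, Matrix.mul_apply, Matrix.smul_apply, Matrix.mul_apply,
      ← Equiv.sum_comp eq.symm, ← Equiv.sum_comp eq.symm, Fintype.sum_sum_type,
      Fintype.sum_sum_type, Fintype.sum_sum_type]
    simp only [matrixPolyFun, Matrix.map_apply, Matrix.conjTranspose_apply, M, N, Matrix.of_apply,
      Equiv.apply_symm_apply, Sum.elim_inl, Sum.elim_inr, Ev, b]
    simpa [evalVec] using key
  have hrep : ∀ (w : ℂ) (x : Fin d → ℂ), ∃ h : B,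
      (∀ z, evalVec z (h : VecPoly d) = (Ev z * (Ev w)ᴴ) *ᵥ x) ∧
      ∀ f : B, ψ f h = star x ⬝ᵥ evalVec w (f : VecPoly d) := by
    intro w x
    refine ⟨∑ k, ((Ev w)ᴴ *ᵥ x) k • b k, ?_, ?_⟩
    · intro z
      rw [← Matrix.mulVec_mulVec]
      ext i
      simp [Matrix.mulVec, dotProduct, Ev, evalVec_add, evalVec_sum, evalVec_smul, mul_comm]
    · intro f
      have h1 : f = ∑ k, ψ f (b k) • b k := by
        rw [Fintype.sum_sum_type]
        exact hexp f
      have h2 : evalVec w (f : VecPoly d) = Ev w *ᵥ fun k => ψ f (b k) := by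
        conv_lhs => rw [h1]
        ext i
        simp [Matrix.mulVec, dotProduct, Ev, evalVec_add, evalVec_sum, evalVec_smul, mul_comm]
      rw [h2, Matrix.dotProduct_mulVec, map_sum, dotProduct]
      refine Finset.sum_congr rfl fun k _ => ?_
      rw [map_smulₛₗ, smul_eq_mul]
      congr 1
      have h3 : star ((Ev w)ᴴ *ᵥ x) = star x ᵥ* Ev w := by
        rw [Matrix.star_mulVec, Matrix.conjTranspose_conjTranspose]
      exact congrFun h3 k
  have hrank : (Matrix.fromCols (matrixPolyFun M α) (matrixPolyFun N α)).rank = d := by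
    suffices h : Function.Injective
        (Matrix.fromCols (matrixPolyFun M α) (matrixPolyFun N α)).vecMul by
      rw [LinearIndependent.rank_matrix (Matrix.vecMul_injective_iff.1 h), Fintype.card_fin]
    refine (injective_iff_map_eq_zero
      (Matrix.fromCols (matrixPolyFun M α) (matrixPolyFun N α)).vecMulLinear).2 fun y hy => ?_
    rw [Matrix.vecMulLinear_apply, Matrix.vecMul_fromCols] at hy
    have hyM : y ᵥ* matrixPolyFun M α = 0 := funext fun j => congrFun hy (Sum.inl j)
    have hyN : y ᵥ* matrixPolyFun N α = 0 := funext fun j => congrFun hy (Sum.inr j)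
    obtain ⟨h, hh, hψ⟩ := hrep α (star y)
    -- A left null vector `y` of both blocks annihilates `(α - w^*) K(α,w)`, so `K(·,α) y^*`
    -- vanishes off one point, hence identically. Then `y` annihilates `B(α)`, and the constant
    -- columns of `M` make it annihilate `C`.
    have hzero : h = 0 := by
      apply Subtype.ext
      refine eq_of_evalVec_eq (D := {conj α}ᶜ) (Set.finite_singleton _).infinite_compl ?_
      intro w hw
      have hw' : α - conj w ≠ 0 := fun h0 => hw (by
        rw [Set.mem_singleton_iff, sub_eq_zero.1 h0, Complex.conj_conj])
      have h1 : y ᵥ* ((α - conj w) • (Ev α * (Ev w)ᴴ)) = 0 := by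
        rw [← hP, Matrix.vecMul_sub, ← Matrix.vecMul_vecMul, ← Matrix.vecMul_vecMul, hyM, hyN]
        simp
      rw [Matrix.vecMul_smul] at h1
      have h2 := congrArg star ((smul_eq_zero.1 h1).resolve_left hw')
      rw [Matrix.star_vecMul, Matrix.conjTranspose_mul, Matrix.conjTranspose_conjTranspose,
        star_zero] at h2
      rw [hh w, h2]
      exact (map_zero (evalLin w)).symm
    have hyall : ∀ v, y ⬝ᵥ v = 0 := by
      intro v
      have hv : v ∈ B.map (evalLin α) ⊔ C := by rw [hC.sup_eq_top]; trivial
      obtain ⟨_, ⟨f, hf, rfl⟩, v', hv', rfl⟩ := Submodule.mem_sup.1 hv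
      have h1 : y ⬝ᵥ evalLin α f = 0 := by
        have h2 := hψ ⟨f, hf⟩
        rw [hzero, map_zero, star_star] at h2
        exact h2.symm
      have h3 : ∀ m, y ⬝ᵥ (c m : Fin d → ℂ) = 0 := by
        intro m
        have h4 := congrFun hyM (eq.symm (Sum.inr m))
        simpa [Matrix.vecMul, dotProduct, matrixPolyFun, M] using h4
      have h5 : ∑ m, c.repr ⟨v', hv'⟩ m • (c m : Fin d → ℂ) = v' := by
        have h6 := congrArg C.subtype (c.sum_repr ⟨v', hv'⟩)
        rwa [map_sum] at h6
      rw [dotProduct_add, h1, zero_add, ← h5]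
      simp [dotProduct_sum, h3]
    exact dotProduct_self_star_eq_zero.1 (hyall (star y))
  obtain ⟨h1, h2⟩ := isNevanlinnaPair_matrixPolyFun Ev hP hrank
  exact ⟨_, hrep, M, N, h1, h2⟩

end NevanlinnaPolynomial

end

open NevanlinnaPolynomial in
theorem corollary6p2 (d : ℕ) (B : Submodule ℂ (VecPoly d)) [FiniteDimensional ℂ B]
    (φ : SesqForm B) (hφ : IsPontryaginForm φ)
    (hK : ∃ K : ℂ → ℂ → Matrix (Fin d) (Fin d) ℂ, IsReproducingKernel B φ K ∧
      ∃ M N : ℂ → Matrix (Fin d) (Fin d) ℂ,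
        IsGeneralizedNevanlinnaPair M N ∧ IsDeterminedBy K M N)
    (J : B →ₗ[ℂ] B) (hJ : IsFundamentalSymmetry φ J) :
    ((∃ K : ℂ → ℂ → Matrix (Fin d) (Fin d) ℂ, IsReproducingKernel B (φ.comp J) K ∧
        ∃ M N : ℂ → Matrix (Fin d) (Fin d) ℂ,
          IsNevanlinnaPair M N ∧ IsDeterminedBy K M N) ↔
      IsSymmetricFor (φ.comp J) (mulOp B)) ∧
    ((∃ K : ℂ → ℂ → Matrix (Fin d) (Fin d) ℂ, IsReproducingKernel B (φ.comp J) K ∧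
        ∃ M N : Matrix (Fin d) (Fin d) (Polynomial ℂ),
          IsNevanlinnaPair (matrixPolyFun M) (matrixPolyFun N) ∧
            IsDeterminedBy K (matrixPolyFun M) (matrixPolyFun N)) ↔
      IsSymmetricFor (φ.comp J) (mulOp B)) := by
  obtain ⟨K, hK, M, N, hMN, hdet⟩ := hK
  -- Only the dimension equality, which is independent of the form, is carried over to `φ.comp J`.
  obtain ⟨-, α, hα⟩ := isSymmetricFor_and_finrank_eq_of_isDeterminedBy B φ hK hMN hdet
  obtain ⟨herm, pos⟩ := hJ.comp_hermitian_and_posDef hφ.hermitian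
  have hpoly := fun hS : IsSymmetricFor (φ.comp J) (mulOp B) =>
    exists_polynomial_pair_of_isSymmetricFor B (φ.comp J) herm pos hS hα
  constructor
  · constructor
    · rintro ⟨K', hK', M', N', hMN', hdet'⟩
      exact (isSymmetricFor_and_finrank_eq_of_isDeterminedBy B _ hK' ⟨0, hMN'⟩ hdet').1
    · intro hS
      obtain ⟨K', hK', M', N', h⟩ := hpoly hS
      exact ⟨K', hK', _, _, h⟩
  · constructor
    · rintro ⟨K', hK', M', N', hMN', hdet'⟩
      exact (isSymmetricFor_and_finrank_eq_of_isDeterminedBy B _ hK' ⟨0, hMN'⟩ hdet').1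
    · exact hpoly
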